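/- **Setting.** Consider a ReLU network with $L\ge 1$ hidden layers, layer $i$ having $n_i$ neurons: $x^0=v$, $z^{i+1}=W^ix^i+b^i$, $x^i=\max(0,z^i)$ and output $f(v)=W^Lx^L+b^L\in\mathbb R^C$. An $l$-layer pattern $A=(A_1,\dots,A_l)$ assigns a sign $A_i(j)\in\{-1,1\}$ to each neuron $(i,j)$ with $i\le l$; it is full if $l=L$. Fixing the signs given by $A$ makes each $z^i_j$ ($i\le l$; for full $A$ also $f$) an affine function of the input, and $R_A=\{v : A_i(j)z^i_j\ge 0 \text{ for } i\le l,\ j\le n_i\}$. If $A'$ differs from $A$ exactly at the neuron $(b,a)$, then $A$ and $A'$ are neighbours, and $\mathrm{Face}(A,A')=\{v : A_i(j)z^i_j\ge 0 \text{ for } i\le l,\ j\le n_i,\ z^b_a=0\}$, with the affine functions given by $A$. Two $l$-layer patterns are neighbouring siblings if in addition $b=l$. Let $q(x,v)$ be a convex distance function: convex in $v$, nonnegative, and zero exactly when $v=x$ (e.g. $q(x,v)=\|x-v\|_p$, $1\le p\le\infty$). For full $A$ and a class $y$, let $D(A)=\min_{j\ne y}\min\{q(x,v): v\in R_A,\ f_y(v)-f_j(v)=0\}$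 (with $\min\emptyset=\infty$); computing it solves one program for each $j\ne y$. Both algorithms take $x$, $y$ and an initial upper bound $U$, and keep a priority queue $Q$ and a set $S$, initially empty. When $Q$ is empty they return $U$. *GeoCert.* Push $(0,A^x)$, where $A^x$ is the full activation pattern of $x$ ($+1$ where $z^i_j(x)\ge 0$, else $-1$). Repeat: pop an entry $(d,A)$ of least $d$; skip it if $A\in S$; add $A$ to $S$; return $U$ if $U\le d$; set $U\gets\min(D(A),U)$; for each neighbour $A'\notin S$ of $A$ solve $\min\{q(x,v):v\in\mathrm{Face}(A,A')\}$ and, if the face is nonempty, push $(d',A')$, with $d'$ the optimal value. *LayerCert-Basic.* Push $(0,A,x)$ with $A$ the first layer of the activation pattern of $x$. Repeat: pop an entry $(d,A,v)$ of least $d$; return $U$ if $U\le d$; if $A$ is full, set $U\gets\min(D(A),U)$, and otherwise push $(d,B,v)$, where $B$ extends $A$ by the signs of the next layer at $v$; for each neighbouring sibling $A'\notin S$ of $A$ solve $\min\{q(x,v):v\in\mathrm{Face}(A,A')\}$ and, if the face is nonempty, push $(d',A',v')$, with $d'$ the optimal value and $v'$ a minimiser, and add $A'$ to $S$. The programs are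 the formal systems written above: an objective together with a set of linear inequalities, each labelled by the neuron (or class) and the sign it comes from; an equation $g=0$ stands for the two inequalities $g\ge 0$ and $-g\ge 0$. In particular the program of a face is solved whether or not the face turns out to be empty (an empty face is an infeasible program), and solving the same program twice counts once. **Theorem.** Fix a network, a convex distance function $q$, an input $x$, a class $y$ and an initial upper bound $U\in[-\infty,\infty]$. Consider any complete run of LayerCert-Basic and any complete run of GeoCert on $(x,y,U)$, with ties and minimisers chosen arbitrarily. Suppose that the value returned by LayerCert-Basic is different from $\min_{v\in R_A}q(x,v)$ for every full pattern $A$ with $R_A\neq\emptyset$. Then there is an injective map from the set of convex programs solved by LayerCert-Basic to the set of convex programs solved by GeoCert such that each program and its image have the same objective, and the constraints of each program are a subset of the constraints of its image. -/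

import Mathlib

noncomputable section

/-- A classification network with `L` hidden ReLU layers, input dimension `n 0`, `n (i+1)` neurons
in the `(i+1)`-st hidden layer (`i < L`) and `C` classes. Only the entries `i < L` of `W` and `b`
are ever used. -/
structure ReLUNet (L : ℕ) (n : ℕ → ℕ) (C : ℕ) where
  W : (i : ℕ) → Matrix (Fin (n (i + 1))) (Fin (n i)) ℝ
  b : (i : ℕ) → Fin (n (i + 1)) → ℝ
  Wout : Matrix (Fin C) (Fin (n L)) ℝ
  bout : Fin C → ℝ

/-- `q x v` is a convex distance function: convex in `v`, nonnegative, and zero exactly at `v = x`.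
Every norm distance, in particular every `ℓ_p` distance with `1 ≤ p ≤ ∞`, is one. -/
structure IsConvexDistance {k : ℕ} (q : (Fin k → ℝ) → (Fin k → ℝ) → ℝ) : Prop where
  convex : ∀ x, ConvexOn ℝ Set.univ (q x)
  nonneg : ∀ x v, 0 ≤ q x v
  eq_zero_iff : ∀ x v, q x v = 0 ↔ v = x

/-- An `l`-layer activation pattern: a sign `±1` for each neuron of the layers `1, …, l`
(layer `i + 1` has index `i`). It is a full pattern if `l = L`. -/
abbrev Pattern (n : ℕ → ℕ) (l : ℕ) : Type := (i : Fin l) → Fin (n (i + 1)) → ℤˣ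

/-- The neurons of the first `l` hidden layers. -/
abbrev Neuron (n : ℕ → ℕ) (l : ℕ) : Type := (i : Fin l) × Fin (n (i + 1))

/-- The neighbouring pattern of `A` that differs from `A` exactly at the neuron `p`. -/
def Pattern.flip {n : ℕ → ℕ} {l : ℕ} (A : Pattern n l) (p : Neuron n l) : Pattern n l :=
  fun i j => if (⟨i, j⟩ : Neuron n l) = p then -A i j else A i j

/-- Where a linear inequality of a program comes from: the inequality `s * z ≥ 0` of the `j`-th
neuron of layer `i + 1`, or the inequality `s * (f_y - f_j) ≥ 0`, half of the equation of the
decision boundary with class `j`. -/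
inductive ConstraintLabel (n : ℕ → ℕ) (C : ℕ) where
  | neuron (i : ℕ) (j : Fin (n (i + 1))) (s : ℤˣ)
  | boundary (j : Fin C) (s : ℤˣ)

/-- The inequality `0 ≤ form v` in the variable `v`, with its label. -/
structure LinConstraint (n : ℕ → ℕ) (C : ℕ) where
  label : ConstraintLabel n C
  form : (Fin (n 0) → ℝ) → ℝ

/-- The set of points that satisfy all of the given constraints. -/
def feasibleSet {n : ℕ → ℕ} {C : ℕ} (K : Set (LinConstraint n C)) : Set (Fin (n 0) → ℝ) :=
  {v | ∀ c ∈ K, 0 ≤ c.form v}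

/-- The program: minimise `objective v` subject to the `constraints`. -/
structure ConvexProgram (n : ℕ → ℕ) (C : ℕ) where
  objective : (Fin (n 0) → ℝ) → ℝ
  constraints : Set (LinConstraint n C)

/-- The optimal value of a program, `⊤` if it is infeasible. -/
def ConvexProgram.value {n : ℕ → ℕ} {C : ℕ} (P : ConvexProgram n C) : EReal :=
  ⨅ v ∈ feasibleSet P.constraints, ((P.objective v : ℝ) : EReal)

namespace ReLUNet

variable {L : ℕ} {n : ℕ → ℕ} {C : ℕ}

/-- The output `x^i` of the `i`-th layer on input `v`. -/
def act (N : ReLUNet L n C) (v : Fin (n 0) → ℝ) : (i : ℕ) → Fin (n i) → ℝ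
  | 0 => v
  | i + 1 => fun j => max 0 (((N.W i).mulVec (N.act v i) + N.b i) j)

/-- The preactivation `z^{i+1} = W^i x^i + b^i` on input `v`. -/
def preact (N : ReLUNet L n C) (v : Fin (n 0) → ℝ) (i : ℕ) : Fin (n (i + 1)) → ℝ :=
  (N.W i).mulVec (N.act v i) + N.b i

/-- The first `l` layers of the activation pattern of `v`. -/
def actPattern (N : ReLUNet L n C) (v : Fin (n 0) → ℝ) (l : ℕ) : Pattern n l :=
  fun i j => if 0 ≤ N.preact v i j then 1 else -1

/-- The output of layer `i` as an affine function of the input `v`, when the ReLUs of the layers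
up to `i ≤ l` are replaced by the 0-1 diagonal matrices given by `A`. -/
def affAct (N : ReLUNet L n C) {l : ℕ} (A : Pattern n l) (v : Fin (n 0) → ℝ) :
    (i : ℕ) → Fin (n i) → ℝ
  | 0 => v
  | i + 1 => fun j =>
      if ∃ h : i < l, A ⟨i, h⟩ j = 1 then ((N.W i).mulVec (N.affAct A v i) + N.b i) j else 0

/-- The preactivation `z^{i+1}` as the affine function of the input given by the pattern `A`. -/
def affPreact (N : ReLUNet L n C) {l : ℕ} (A : Pattern n l) (v : Fin (n 0) → ℝ) (i : ℕ) :
    Fin (n (i + 1)) → ℝ :=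
  (N.W i).mulVec (N.affAct A v i) + N.b i

/-- The network output `f` as the affine function of the input given by a full pattern `A`. -/
def affOut (N : ReLUNet L n C) (A : Pattern n L) (v : Fin (n 0) → ℝ) : Fin C → ℝ :=
  N.Wout.mulVec (N.affAct A v L) + N.bout

/-- The inequality `s * z ≥ 0` at the neuron `p`, with `z` the affine function given by `A`. -/
def signConstraint (N : ReLUNet L n C) {l : ℕ} (A : Pattern n l) (p : Neuron n l) (s : ℤˣ) :
    LinConstraint n C where
  label := .neuron p.1 p.2 s
  form := fun v => ((s : ℤ) : ℝ) * N.affPreact A v p.1 p.2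

/-- `A_i(j) z^i_j ≥ 0` for all neurons of the layers of `A`. -/
def regionConstraints (N : ReLUNet L n C) {l : ℕ} (A : Pattern n l) : Set (LinConstraint n C) :=
  Set.range fun p : Neuron n l => N.signConstraint A p (A p.1 p.2)

/-- The (partial) activation region `R_A`, as a polyhedron. -/
def region (N : ReLUNet L n C) {l : ℕ} (A : Pattern n l) : Set (Fin (n 0) → ℝ) :=
  feasibleSet (N.regionConstraints A)

/-- The constraints of the face between `A` and `A.flip p`: those of `R_A` and `z = 0` at the
neuron `p`; the equation is written as the two inequalities `z ≥ 0` and `-z ≥ 0`. -/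
def faceConstraints (N : ReLUNet L n C) {l : ℕ} (A : Pattern n l) (p : Neuron n l) :
    Set (LinConstraint n C) :=
  N.regionConstraints A ∪ {N.signConstraint A p 1, N.signConstraint A p (-1)}

/-- The face between `A` and `A.flip p`. -/
def face (N : ReLUNet L n C) {l : ℕ} (A : Pattern n l) (p : Neuron n l) : Set (Fin (n 0) → ℝ) :=
  feasibleSet (N.faceConstraints A p)

/-- One half of the equation `f_y - f_j = 0` within the region of the full pattern `A`. -/
def boundaryConstraint (N : ReLUNet L n C) (A : Pattern n L) (y j : Fin C) (s : ℤˣ) :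
    LinConstraint n C where
  label := .boundary j s
  form := fun v => ((s : ℤ) : ℝ) * (N.affOut A v y - N.affOut A v j)

/-- The constraints `v ∈ R_A`, `f_y(v) - f_j(v) = 0`. -/
def boundaryConstraints (N : ReLUNet L n C) (A : Pattern n L) (y j : Fin C) :
    Set (LinConstraint n C) :=
  N.regionConstraints A ∪ {N.boundaryConstraint A y j 1, N.boundaryConstraint A y j (-1)}

variable (N : ReLUNet L n C) (q : (Fin (n 0) → ℝ) → (Fin (n 0) → ℝ) → ℝ) (x : Fin (n 0) → ℝ)

/-- The distance of `x` from the (partial) activation region of `A`. -/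
def regionDist {l : ℕ} (A : Pattern n l) : EReal :=
  ⨅ v ∈ N.region A, ((q x v : ℝ) : EReal)

/-- The program of `priority`: minimise `q x v` over the face between `A` and `A.flip p`. -/
def faceProgram {l : ℕ} (A : Pattern n l) (p : Neuron n l) : ConvexProgram n C :=
  ⟨q x, N.faceConstraints A p⟩

/-- The program of `decision_bound` for the class `j`. -/
def boundaryProgram (A : Pattern n L) (y j : Fin C) : ConvexProgram n C :=
  ⟨q x, N.boundaryConstraints A y j⟩

/-- `decision_bound(A, x, y)`. -/
def decisionBound (A : Pattern n L) (y : Fin C) : EReal :=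
  ⨅ (j : Fin C) (_ : j ≠ y), (N.boundaryProgram q x A y j).value

/-- The programs solved by `decision_bound(A, x, y)`. -/
def boundaryPrograms (A : Pattern n L) (y : Fin C) : Set (ConvexProgram n C) :=
  {P | ∃ j, j ≠ y ∧ P = N.boundaryProgram q x A y j}

end ReLUNet

/-! ### GeoCert -/

/-- The state of GeoCert at the head of its loop, with the set of programs solved so far. -/
structure GeoState (L : ℕ) (n : ℕ → ℕ) (C : ℕ) where
  queue : Multiset (EReal × Pattern n L)
  seen : Set (Pattern n L)
  bound : EReal
  solved : Set (ConvexProgram n C)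

namespace ReLUNet

variable {L : ℕ} {n : ℕ → ℕ} {C : ℕ} (N : ReLUNet L n C)
  (q : (Fin (n 0) → ℝ) → (Fin (n 0) → ℝ) → ℝ) (x : Fin (n 0) → ℝ) (y : Fin C)

/-- Popping a queue: `e` is an entry of least priority and `Q` is what remains. Ties may be broken
in any way. -/
def _root_.PopsMin {α : Type} (queue : Multiset α) (prio : α → EReal) (e : α)
    (Q : Multiset α) : Prop :=
  queue = e ::ₘ Q ∧ ∀ e' ∈ Q, prio e ≤ prio e'

/-- The start of GeoCert with initial upper bound `U`. -/
def geoInit (U : EReal) : GeoState L n C where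
  queue := {(0, N.actPattern x L)}
  seen := ∅
  bound := U
  solved := ∅

open Classical in
/-- The entries that GeoCert pushes when it processes `A`, if `seen` is the updated set of seen
patterns. -/
def geoPushes (seen : Set (Pattern n L)) (A : Pattern n L) : Multiset (EReal × Pattern n L) :=
  (Finset.univ.filter fun p : Neuron n L => A.flip p ∉ seen ∧ (N.face A p).Nonempty).val.map
    fun p => ((N.faceProgram q x A p).value, A.flip p)

/-- The face programs that GeoCert solves when it processes `A`: one for each unseen neighbour.
(The program is solved to find out whether the face is empty; if it is not, its optimal value is
the priority that is pushed.) -/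
def geoFacePrograms (seen : Set (Pattern n L)) (A : Pattern n L) : Set (ConvexProgram n C) :=
  {P | ∃ p : Neuron n L, A.flip p ∉ seen ∧ P = N.faceProgram q x A p}

/-- One iteration of the loop of GeoCert that does not return. -/
inductive GeoStep : GeoState L n C → GeoState L n C → Prop
  | skip (st : GeoState L n C) (d : EReal) (A : Pattern n L) (Q : Multiset (EReal × Pattern n L))
      (hpop : PopsMin st.queue Prod.fst (d, A) Q) (hA : A ∈ st.seen) :
      GeoStep st { st with queue := Q }
  | process (st : GeoState L n C) (d : EReal) (A : Pattern n L)
      (Q : Multiset (EReal × Pattern n L))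
      (hpop : PopsMin st.queue Prod.fst (d, A) Q) (hA : A ∉ st.seen) (hU : ¬ st.bound ≤ d) :
      GeoStep st
        { queue := Q + N.geoPushes q x (insert A st.seen) A
          seen := insert A st.seen
          bound := min (N.decisionBound q x A y) st.bound
          solved := st.solved ∪ N.boundaryPrograms q x A y
            ∪ N.geoFacePrograms q x (insert A st.seen) A }

/-- GeoCert stops at this state: the queue is empty, or the next iteration returns. -/
def _root_.GeoState.Halts (st : GeoState L n C) : Prop :=
  st.queue = 0 ∨ ∃ d A Q, PopsMin st.queue Prod.fst (d, A) Q ∧ A ∉ st.seen ∧ st.bound ≤ d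

/-- Some complete run of GeoCert on input `x`, `y`, `U` returns `ε` after solving exactly the
programs in `P`. -/
def GeoCertRun (U ε : EReal) (P : Set (ConvexProgram n C)) : Prop :=
  ∃ st : GeoState L n C, Relation.ReflTransGen (N.GeoStep q x y) (N.geoInit x U) st ∧
    st.Halts ∧ st.bound = ε ∧ st.solved = P

end ReLUNet

/-! ### LayerCert-Basic -/

/-- A queue entry `(d, A, v)` of LayerCert-Basic, where `A` is a pattern of any level. -/
structure LayerEntry (n : ℕ → ℕ) where
  prio : EReal
  level : ℕ
  pattern : Pattern n level
  point : Fin (n 0) → ℝ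

/-- The state of LayerCert-Basic at the head of its loop, with the set of programs solved so far. -/
structure LayerState (n : ℕ → ℕ) (C : ℕ) where
  queue : Multiset (LayerEntry n)
  seen : Set ((l : ℕ) × Pattern n l)
  bound : EReal
  solved : Set (ConvexProgram n C)

namespace ReLUNet

variable {L : ℕ} {n : ℕ → ℕ} {C : ℕ} (N : ReLUNet L n C)
  (q : (Fin (n 0) → ℝ) → (Fin (n 0) → ℝ) → ℝ) (x : Fin (n 0) → ℝ) (y : Fin C)

/-- `next_layer(A, v)`. -/
def nextLayer {l : ℕ} (A : Pattern n l) (v : Fin (n 0) → ℝ) : Pattern n (l + 1) :=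
  fun i j => if h : (i : ℕ) < l then A ⟨i, h⟩ j else N.actPattern v (l + 1) i j

/-- The start of LayerCert-Basic with initial upper bound `U`. -/
def layerInit (U : EReal) : LayerState n C where
  queue := {⟨0, 1, N.actPattern x 1, x⟩}
  seen := ∅
  bound := U
  solved := ∅

/-- `A.flip p` is a neighbour of `A` in the current (last) layer of `A` that is not yet seen. -/
def IsNewSibling (seen : Set ((l : ℕ) × Pattern n l)) {l : ℕ} (A : Pattern n l)
    (p : Neuron n l) : Prop :=
  (p.1 : ℕ) + 1 = l ∧ (⟨l, A.flip p⟩ : (l : ℕ) × Pattern n l) ∉ seen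

open Classical in
/-- The neurons whose flip gives an unseen sibling of `A` across a nonempty face. -/
def newSiblings (seen : Set ((l : ℕ) × Pattern n l)) {l : ℕ} (A : Pattern n l) :
    Finset (Neuron n l) :=
  Finset.univ.filter fun p => IsNewSibling seen A p ∧ (N.face A p).Nonempty

/-- `m` picks, for each of the new siblings, a closest point of the face. -/
def IsPriorityChoice (seen : Set ((l : ℕ) × Pattern n l)) {l : ℕ} (A : Pattern n l)
    (m : Neuron n l → Fin (n 0) → ℝ) : Prop :=
  ∀ p ∈ N.newSiblings seen A, m p ∈ N.face A p ∧ ∀ w ∈ N.face A p, q x (m p) ≤ q x w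

/-- The entries that LayerCert-Basic pushes for the siblings of `A`. -/
def layerPushes (seen : Set ((l : ℕ) × Pattern n l)) {l : ℕ} (A : Pattern n l)
    (m : Neuron n l → Fin (n 0) → ℝ) : Multiset (LayerEntry n) :=
  (N.newSiblings seen A).val.map fun p => ⟨((q x (m p) : ℝ) : EReal), l, A.flip p, m p⟩

/-- The set of seen patterns after `A` has been processed. -/
def layerSeen (seen : Set ((l : ℕ) × Pattern n l)) {l : ℕ} (A : Pattern n l) :
    Set ((l : ℕ) × Pattern n l) :=
  seen ∪ {B | ∃ p ∈ N.newSiblings seen A, B = ⟨l, A.flip p⟩}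

/-- The face programs that LayerCert-Basic solves when it processes `A`: one for each unseen
neighbouring sibling. (As for GeoCert, solving it also decides whether the face is empty.) -/
def layerFacePrograms (seen : Set ((l : ℕ) × Pattern n l)) {l : ℕ} (A : Pattern n l) :
    Set (ConvexProgram n C) :=
  {P | ∃ p : Neuron n l, IsNewSibling seen A p ∧ P = N.faceProgram q x A p}

/-- One iteration of the loop of LayerCert-Basic that does not return. -/
inductive LayerStep : LayerState n C → LayerState n C → Prop
  | last (st : LayerState n C) (d : EReal) (A : Pattern n L) (v : Fin (n 0) → ℝ)
      (Q : Multiset (LayerEntry n)) (m : Neuron n L → Fin (n 0) → ℝ)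
      (hpop : PopsMin st.queue LayerEntry.prio ⟨d, L, A, v⟩ Q) (hU : ¬ st.bound ≤ d)
      (hm : N.IsPriorityChoice q x st.seen A m) :
      LayerStep st
        { queue := Q + N.layerPushes q x st.seen A m
          seen := N.layerSeen st.seen A
          bound := min (N.decisionBound q x A y) st.bound
          solved := st.solved ∪ N.boundaryPrograms q x A y ∪ N.layerFacePrograms q x st.seen A }
  | inner (st : LayerState n C) (d : EReal) (l : ℕ) (A : Pattern n l) (v : Fin (n 0) → ℝ)
      (Q : Multiset (LayerEntry n)) (m : Neuron n l → Fin (n 0) → ℝ)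
      (hpop : PopsMin st.queue LayerEntry.prio ⟨d, l, A, v⟩ Q) (hU : ¬ st.bound ≤ d)
      (hl : l ≠ L) (hm : N.IsPriorityChoice q x st.seen A m) :
      LayerStep st
        { queue := ⟨d, l + 1, N.nextLayer A v, v⟩ ::ₘ (Q + N.layerPushes q x st.seen A m)
          seen := N.layerSeen st.seen A
          bound := st.bound
          solved := st.solved ∪ N.layerFacePrograms q x st.seen A }

/-- LayerCert-Basic stops at this state: the queue is empty, or the next iteration returns. -/
def _root_.LayerState.Halts (st : LayerState n C) : Prop :=
  st.queue = 0 ∨ ∃ e Q, PopsMin st.queue LayerEntry.prio e Q ∧ st.bound ≤ e.prio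

/-- Some complete run of LayerCert-Basic on input `x`, `y`, `U` returns `ε` after solving exactly
the programs in `P`. -/
def LayerCertRun (U ε : EReal) (P : Set (ConvexProgram n C)) : Prop :=
  ∃ st : LayerState n C, Relation.ReflTransGen (N.LayerStep q x y) (N.layerInit x U) st ∧
    st.Halts ∧ st.bound = ε ∧ st.solved = P

end ReLUNet

end

/-!
The region `R_A` of a pattern consists of the points at which `A` is a possible choice of the signs
of the network's true preactivations (`mem_region_iff`). So regions are closed and convex, those of
all the extensions of a fixed pattern cover its region, and a face is the intersection of the two
regions beside it. Zero preactivations leave all choices of sign open, so the patterns that contain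
a given point are joined by flips across faces through it. As segments are connected, this gives
`exists_crossing`: along a segment from `R_A` to `R_B` one can leave any set of patterns that
contains `A` but not `B` by a flip across a face that meets the segment. No general position is
assumed. The distance `q x` is at most the larger of its two end values on a segment, and so both
searches are complete below the value at which they stop.

* GeoCert processes every full pattern whose region has a point closer to `x` than the returned
  value (`IsGeoHistory.mem_seen_of_halts`): use a segment that starts at `x`.
* In LayerCert-Basic a pattern is pushed as a sibling only when it is first seen, and the priority
  given to it then need not be its distance; a pattern pushed as a next layer may also be pushed
  again as a sibling. Neighbouring siblings are separated by a hyperplane in the region of their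
  parent, so the priority of the new sibling is off only for points closer to `x` than the entry
  being processed, and for those the sibling has been processed already. Hence, once all entries in
  the queue are above `r`, all patterns at distance at most `r` have been processed with priority at
  most `r` (`IsLayerHistory.exists_processed`).

It follows that the value of LayerCert-Basic is at most that of GeoCert. Moreover, no full pattern
that is closer to `x` than a processed entry has its decision bound below the priority `d` of this
entry. As the returned value is not the distance of a full region, it exceeds `d`
(`IsLayerHistory.prio_lt_bound`). So GeoCert processes every full pattern that extends the pattern
of the entry and contains its point.

A boundary program is mapped to itself, and the face program of an `l`-layer pattern `A` at a neuron
of layer `l` to the face program, at the same neuron, of such a full extension or of its neighbour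
there, whichever GeoCert solved. The two siblings `A` and `A.flip p` have the same face program,
because its affine functions do not involve the signs of layer `l`. The image determines its neuron,
the only one with both signs, hence `l`, hence the original program, which consists of the
constraints of the first `l` layers. This makes the map injective (`IsCounterpart.left_unique`).
-/

/-! ### Patterns -/

namespace Pattern

variable {n : ℕ → ℕ} {l : ℕ}

theorem flip_apply_self (A : Pattern n l) (p : Neuron n l) : A.flip p p.1 p.2 = -A p.1 p.2 := by
  simp [Pattern.flip]

theorem flip_apply_of_ne (A : Pattern n l) {p r : Neuron n l} (h : r ≠ p) :
    A.flip p r.1 r.2 = A r.1 r.2 := if_neg h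

theorem flip_flip (A : Pattern n l) (p : Neuron n l) : (A.flip p).flip p = A := by
  funext i j
  by_cases h : (⟨i, j⟩ : Neuron n l) = p
  · subst h
    simpa using ((A.flip ⟨i, j⟩).flip_apply_self ⟨i, j⟩).trans
      (congrArg Neg.neg (A.flip_apply_self ⟨i, j⟩))
  · exact ((A.flip p).flip_apply_of_ne h).trans (A.flip_apply_of_ne h)

theorem flip_ne (A : Pattern n l) (p : Neuron n l) : A.flip p ≠ A := by
  intro h
  have h1 := A.flip_apply_self p
  rw [h] at h1
  rcases Int.units_eq_one_or (A p.1 p.2) with h2 | h2 <;> rw [h2] at h1 <;> revert h1 <;> decide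

/-- The first `m` layers of a pattern. -/
def truncate {m : ℕ} (A : Pattern n l) (h : m ≤ l) : Pattern n m :=
  fun i j => A ⟨i, i.2.trans_le h⟩ j

end Pattern

/-- A neuron of the first `m` layers, regarded as a neuron of the first `l ≥ m` layers. -/
def liftNeuron {n : ℕ → ℕ} {m l : ℕ} (h : m ≤ l) (p : Neuron n m) : Neuron n l :=
  ⟨⟨p.1, p.1.2.trans_le h⟩, p.2⟩

theorem liftNeuron_injective {n : ℕ → ℕ} {m l : ℕ} (h : m ≤ l) :
    Function.Injective (liftNeuron (n := n) h) := by
  rintro ⟨⟨i, hi⟩, j⟩ ⟨⟨i', hi'⟩, j'⟩ he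
  simp only [liftNeuron, Sigma.mk.injEq, Fin.mk.injEq] at he
  obtain ⟨rfl, he⟩ := he
  rw [eq_of_heq he]

theorem Pattern.truncate_flip {n : ℕ → ℕ} {m l : ℕ} (h : m ≤ l) (A : Pattern n l)
    (p : Neuron n m) : (A.flip (liftNeuron h p)).truncate h = (A.truncate h).flip p := by
  funext i j
  by_cases hp : (⟨i, j⟩ : Neuron n m) = p
  · subst hp
    exact (A.flip_apply_self (liftNeuron h ⟨i, j⟩)).trans
      ((A.truncate h).flip_apply_self ⟨i, j⟩).symm
  · have hne : liftNeuron h ⟨i, j⟩ ≠ liftNeuron h p := fun he => hp (liftNeuron_injective h he)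
    exact (A.flip_apply_of_ne hne).trans ((A.truncate h).flip_apply_of_ne hp).symm

/-! ### Activation regions -/

namespace ReLUNet

variable {L : ℕ} {n : ℕ → ℕ} {C : ℕ} (N : ReLUNet L n C)

/-- `A`, continued up to layer `m` by the signs of the preactivations at `v`. -/
noncomputable def extendAt {l : ℕ} (A : Pattern n l) (v : Fin (n 0) → ℝ) (m : ℕ) : Pattern n m :=
  fun i j => if h : (i : ℕ) < l then A ⟨i, h⟩ j else N.actPattern v m i j

theorem truncate_extendAt {l m : ℕ} (h : l ≤ m) (A : Pattern n l) (v : Fin (n 0) → ℝ) :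
    (N.extendAt A v m).truncate h = A := by
  funext i j
  simp [Pattern.truncate, extendAt]

theorem affAct_congr {l l' : ℕ} (A : Pattern n l) (B : Pattern n l') (v : Fin (n 0) → ℝ) (i : ℕ)
    (hl : i ≤ l) (hl' : i ≤ l')
    (h : ∀ k (hk : k < i), A ⟨k, hk.trans_le hl⟩ = B ⟨k, hk.trans_le hl'⟩) :
    N.affAct A v i = N.affAct B v i := by
  induction i with
  | zero => rfl
  | succ i ih =>
    have ih := ih (by omega) (by omega) fun k hk => h k (by omega)
    have hi := h i (by omega)
    funext j
    simp only [affAct, ih, exists_prop_of_true (show i < l by omega),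
      exists_prop_of_true (show i < l' by omega), hi]

theorem affPreact_congr {l l' : ℕ} (A : Pattern n l) (B : Pattern n l') (v : Fin (n 0) → ℝ) (i : ℕ)
    (hl : i ≤ l) (hl' : i ≤ l')
    (h : ∀ k (hk : k < i), A ⟨k, hk.trans_le hl⟩ = B ⟨k, hk.trans_le hl'⟩) :
    N.affPreact A v i = N.affPreact B v i := by
  rw [affPreact, affPreact, N.affAct_congr A B v i hl hl' h]

theorem affPreact_truncate {m l : ℕ} (h : m ≤ l) (A : Pattern n l) (v : Fin (n 0) → ℝ) {i : ℕ}
    (hi : i ≤ m) : N.affPreact (A.truncate h) v i = N.affPreact A v i :=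
  N.affPreact_congr _ _ v i hi (hi.trans h) fun _ _ => rfl

/-- The preactivations of the layers of `A` do not depend on the signs of the last layer of `A`. -/
theorem affPreact_flip {l : ℕ} (A : Pattern n l) {p : Neuron n l} (hp : (p.1 : ℕ) + 1 = l)
    (v : Fin (n 0) → ℝ) {i : ℕ} (hi : i < l) :
    N.affPreact (A.flip p) v i = N.affPreact A v i := by
  refine N.affPreact_congr _ _ v i hi.le hi.le fun k hk => ?_
  funext j
  refine A.flip_apply_of_ne (p := p) (r := ⟨⟨k, by omega⟩, j⟩) ?_
  intro h
  have : k = (p.1 : ℕ) := congrArg (fun r : Neuron n l => (r.1 : ℕ)) h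
  omega

theorem mem_region {l : ℕ} {A : Pattern n l} {v : Fin (n 0) → ℝ} :
    v ∈ N.region A ↔
      ∀ p : Neuron n l, 0 ≤ ((A p.1 p.2 : ℤ) : ℝ) * N.affPreact A v p.1 p.2 := by
  simp only [region, feasibleSet, regionConstraints, Set.forall_mem_range, Set.mem_ofPred_eq,
    signConstraint]

theorem affAct_eq_act {l : ℕ} (A : Pattern n l) (v : Fin (n 0) → ℝ) (i : ℕ) (hi : i ≤ l)
    (h : ∀ p : Neuron n l, (p.1 : ℕ) < i →
      0 ≤ ((A p.1 p.2 : ℤ) : ℝ) * N.affPreact A v p.1 p.2 ∨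
        0 ≤ ((A p.1 p.2 : ℤ) : ℝ) * N.preact v p.1 p.2) :
    N.affAct A v i = N.act v i := by
  induction i with
  | zero => rfl
  | succ i ih =>
    have ih := ih (by omega) fun p hp => h p (by omega)
    have hpre : N.affPreact A v i = N.preact v i := by rw [affPreact, preact, ih]
    funext j
    have hj := h ⟨⟨i, by omega⟩, j⟩ (Nat.lt_succ_self i)
    simp only [hpre, or_self] at hj
    simp only [preact] at hj
    simp only [affAct, act, ih, exists_prop_of_true (show i < l by omega)]
    rcases Int.units_eq_one_or (A ⟨i, by omega⟩ j) with hA | hA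
    · rw [hA] at hj
      rw [if_pos hA, max_eq_right (by simpa using hj)]
    · rw [hA] at hj
      rw [Units.val_neg, Units.val_one, Int.cast_neg, Int.cast_one, neg_one_mul,
        Left.nonneg_neg_iff] at hj
      rw [if_neg (by rw [hA]; decide), max_eq_left hj]

/-- On the region of `A` the affine preactivations given by `A` are those of the network. -/
theorem affPreact_eq_preact {l : ℕ} {A : Pattern n l} {v : Fin (n 0) → ℝ} (hv : v ∈ N.region A)
    {i : ℕ} (hi : i ≤ l) : N.affPreact A v i = N.preact v i := by
  rw [affPreact, preact, N.affAct_eq_act A v i hi fun p _ => Or.inl (N.mem_region.1 hv p)]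

/-- A point lies in the region of `A` if and only if `A` is a possible choice of the signs of the
preactivations of the network at this point. -/
theorem mem_region_iff {l : ℕ} {A : Pattern n l} {v : Fin (n 0) → ℝ} :
    v ∈ N.region A ↔
      ∀ p : Neuron n l, 0 ≤ ((A p.1 p.2 : ℤ) : ℝ) * N.preact v p.1 p.2 := by
  refine ⟨fun h p => ?_, fun h => N.mem_region.2 fun p => ?_⟩
  · rw [← N.affPreact_eq_preact h p.1.2.le]
    exact N.mem_region.1 h p
  · rw [affPreact, N.affAct_eq_act A v p.1 p.1.2.le fun r _ => Or.inr (h r)]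
    exact h p

theorem mem_face {l : ℕ} {A : Pattern n l} {p : Neuron n l} {v : Fin (n 0) → ℝ} :
    v ∈ N.face A p ↔ v ∈ N.region A ∧ N.affPreact A v p.1 p.2 = 0 := by
  have : v ∈ N.face A p ↔ v ∈ N.region A ∧
      0 ≤ (N.signConstraint A p 1).form v ∧ 0 ≤ (N.signConstraint A p (-1)).form v := by
    simp only [face, region, feasibleSet, faceConstraints, Set.mem_ofPred_eq, Set.mem_union,
      Set.mem_insert_iff, Set.mem_singleton_iff, or_imp, forall_and, forall_eq]
  rw [this]
  simp only [signConstraint, Units.val_one, Units.val_neg, Int.cast_neg, Int.cast_one, one_mul,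
    neg_mul, Left.nonneg_neg_iff]
  exact and_congr_right fun _ => ⟨fun h => le_antisymm h.2 h.1, fun h => ⟨h.ge, h.le⟩⟩

/-- The face between two neighbours is the intersection of their regions. -/
theorem mem_face_iff {l : ℕ} {A : Pattern n l} {p : Neuron n l} {v : Fin (n 0) → ℝ} :
    v ∈ N.face A p ↔ v ∈ N.region A ∧ v ∈ N.region (A.flip p) := by
  rw [mem_face]
  refine and_congr_right fun hA => ?_
  rw [N.affPreact_eq_preact hA p.1.2.le]
  rw [mem_region_iff] at hA ⊢
  constructor
  · intro h r
    by_cases hr : r = p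
    · subst hr
      rw [h, mul_zero]
    · rw [A.flip_apply_of_ne hr]
      exact hA r
  · intro h
    have h1 := hA p
    have h2 := h p
    rw [A.flip_apply_self, Units.val_neg, Int.cast_neg, neg_mul] at h2
    have h3 : ((A p.1 p.2 : ℤ) : ℝ) * N.preact v p.1 p.2 = 0 := by linarith
    exact (mul_eq_zero.1 h3).resolve_left (by simp)

theorem actPattern_mul_preact_nonneg (v : Fin (n 0) → ℝ) {m : ℕ} (p : Neuron n m) :
    0 ≤ ((N.actPattern v m p.1 p.2 : ℤ) : ℝ) * N.preact v p.1 p.2 := by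
  unfold actPattern
  split_ifs with h
  · simpa using h
  · simpa using (not_le.1 h).le

theorem mem_region_actPattern (v : Fin (n 0) → ℝ) (m : ℕ) : v ∈ N.region (N.actPattern v m) :=
  N.mem_region_iff.2 fun p => N.actPattern_mul_preact_nonneg v p

theorem mem_region_extendAt {l : ℕ} {A : Pattern n l} {v : Fin (n 0) → ℝ} (hv : v ∈ N.region A)
    (m : ℕ) : v ∈ N.region (N.extendAt A v m) := by
  refine N.mem_region_iff.2 fun p => ?_
  unfold extendAt
  split_ifs with h
  · exact N.mem_region_iff.1 hv ⟨⟨p.1, h⟩, p.2⟩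
  · exact N.actPattern_mul_preact_nonneg v p

theorem mem_region_truncate {m l : ℕ} (h : m ≤ l) {A : Pattern n l} {v : Fin (n 0) → ℝ}
    (hv : v ∈ N.region A) : v ∈ N.region (A.truncate h) :=
  N.mem_region_iff.2 fun p => N.mem_region_iff.1 hv (liftNeuron h p)

theorem continuous_act (i : ℕ) : Continuous fun v => N.act v i := by
  induction i with
  | zero => exact continuous_id
  | succ i ih =>
    refine continuous_pi fun j => continuous_const.max ?_
    exact (continuous_apply j).comp ((continuous_const.matrix_mulVec ih).add continuous_const)

theorem continuous_preact (i : ℕ) (j : Fin (n (i + 1))) : Continuous fun v => N.preact v i j :=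
  (continuous_apply j).comp
    ((continuous_const.matrix_mulVec (N.continuous_act i)).add continuous_const)

theorem isClosed_region {l : ℕ} (A : Pattern n l) : IsClosed (N.region A) := by
  have : N.region A = ⋂ p : Neuron n l,
      {v | 0 ≤ ((A p.1 p.2 : ℤ) : ℝ) * N.preact v p.1 p.2} := by
    ext v
    simp only [mem_region_iff, Set.mem_iInter, Set.mem_ofPred_eq]
  rw [this]
  exact isClosed_iInter fun p =>
    isClosed_le continuous_const (continuous_const.mul (N.continuous_preact _ _))

theorem affAct_combo {l : ℕ} (A : Pattern n l) (u w : Fin (n 0) → ℝ) {a b : ℝ} (hab : a + b = 1)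
    (i : ℕ) : N.affAct A (a • u + b • w) i = a • N.affAct A u i + b • N.affAct A w i := by
  induction i with
  | zero => rfl
  | succ i ih =>
    funext j
    simp only [affAct, ih, Pi.add_apply, Pi.smul_apply, smul_eq_mul, Matrix.mulVec_add,
      Matrix.mulVec_smul]
    split_ifs
    · linear_combination (-N.b i j) * hab
    · ring

theorem affPreact_combo {l : ℕ} (A : Pattern n l) (u w : Fin (n 0) → ℝ) {a b : ℝ}
    (hab : a + b = 1) (i : ℕ) (j : Fin (n (i + 1))) :
    N.affPreact A (a • u + b • w) i j = a * N.affPreact A u i j + b * N.affPreact A w i j := by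
  simp only [affPreact, N.affAct_combo A u w hab, Pi.add_apply, Pi.smul_apply, smul_eq_mul,
    Matrix.mulVec_add, Matrix.mulVec_smul]
  linear_combination (-N.b i j) * hab

theorem convex_region {l : ℕ} (A : Pattern n l) : Convex ℝ (N.region A) := by
  intro u hu w hw a b ha hb hab
  refine N.mem_region.2 fun p => ?_
  have h1 := mul_nonneg ha (N.mem_region.1 hu p)
  have h2 := mul_nonneg hb (N.mem_region.1 hw p)
  rw [N.affPreact_combo A u w hab]
  linarith

/-- The regions of two neighbouring siblings lie on the two sides of a hyperplane in the region of
their parent, so that a segment from one to the other meets their face. -/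
theorem exists_mem_segment_face {l : ℕ} {A : Pattern n l} {p : Neuron n l}
    (hp : (p.1 : ℕ) + 1 = l) {u w : Fin (n 0) → ℝ} (hu : u ∈ N.region A)
    (hw : w ∈ N.region (A.flip p)) : ∃ c ∈ segment ℝ u w, c ∈ N.face A p := by
  have hw' : ∀ r : Neuron n l, 0 ≤ ((A.flip p r.1 r.2 : ℤ) : ℝ) * N.affPreact A w r.1 r.2 := by
    intro r
    rw [← N.affPreact_flip A hp w r.1.2]
    exact N.mem_region.1 hw r
  have hu' := N.mem_region.1 hu
  obtain ⟨a, b, ha, hb, hab, h0⟩ : ∃ a b : ℝ, 0 ≤ a ∧ 0 ≤ b ∧ a + b = 1 ∧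
      a * N.affPreact A u p.1 p.2 + b * N.affPreact A w p.1 p.2 = 0 := by
    have h1 := hu' p
    have h2 := hw' p
    rw [A.flip_apply_self, Units.val_neg, Int.cast_neg, neg_mul] at h2
    have hs : (0 : ℝ) ∈ segment ℝ (N.affPreact A u p.1 p.2) (N.affPreact A w p.1 p.2) := by
      rw [segment_eq_uIcc, Set.mem_uIcc]
      rcases Int.units_eq_one_or (A p.1 p.2) with h | h <;> rw [h] at h1 h2 <;>
        simp at h1 h2
      · exact Or.inr ⟨h2, h1⟩
      · exact Or.inl ⟨h1, h2⟩
    exact hs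
  refine ⟨a • u + b • w, ⟨a, b, ha, hb, hab, rfl⟩, N.mem_face.2 ⟨N.mem_region.2 fun r => ?_, ?_⟩⟩
  · by_cases hr : r = p
    · subst hr
      rw [N.affPreact_combo A u w hab, h0, mul_zero]
    · have h1 := mul_nonneg ha (hu' r)
      have h2 := mul_nonneg hb (hw' r)
      rw [A.flip_apply_of_ne hr] at h2
      rw [N.affPreact_combo A u w hab]
      linarith
  · rw [N.affPreact_combo A u w hab, h0]

/-! ### Connectivity of the regions along a segment -/

/-- The patterns whose regions contain `w` form a cube, in which any two are joined by a path of
flips. -/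
theorem exists_flip_notMem {l : ℕ} {w : Fin (n 0) → ℝ} {T : Set (Pattern n l)} {B : Pattern n l}
    (hB : B ∉ T) (hwB : w ∈ N.region B) (m : ℕ) (A : Pattern n l) (hA : A ∈ T)
    (hwA : w ∈ N.region A)
    (hAB : ∀ p : Neuron n l, (p.1 : ℕ) < m → A p.1 p.2 = B p.1 p.2) :
    ∃ A ∈ T, ∃ p : Neuron n l, m ≤ (p.1 : ℕ) ∧ A.flip p ∉ T ∧ w ∈ N.face A p := by
  induction hk : (Finset.univ.filter fun p : Neuron n l => A p.1 p.2 ≠ B p.1 p.2).card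
    using Nat.strong_induction_on generalizing A with
  | _ k ih =>
    have hne : A ≠ B := fun h => hB (h ▸ hA)
    obtain ⟨p, hp⟩ : ∃ p : Neuron n l, A p.1 p.2 ≠ B p.1 p.2 := by
      by_contra! h
      exact hne (funext fun i => funext fun j => h ⟨i, j⟩)
    have hpm : m ≤ (p.1 : ℕ) := not_lt.1 fun h => hp (hAB p h)
    have hself : A.flip p p.1 p.2 = B p.1 p.2 := by
      rw [A.flip_apply_self, Int.units_ne_iff_eq_neg.1 hp, neg_neg]
    have hw : w ∈ N.region (A.flip p) := by
      refine N.mem_region_iff.2 fun r => ?_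
      by_cases hr : r = p
      · subst hr
        rw [hself]
        exact N.mem_region_iff.1 hwB r
      · rw [A.flip_apply_of_ne hr]
        exact N.mem_region_iff.1 hwA r
    by_cases hT : A.flip p ∈ T
    · refine ih _ ?_ (A.flip p) hT hw (fun r hr => ?_) rfl
      · rw [← hk]
        refine Finset.card_lt_card (Finset.ssubset_iff_of_subset (fun r hr => ?_) |>.2
          ⟨p, by simpa using hp, by simpa using hself⟩)
        have hrp : r ≠ p := by
          rintro rfl
          exact (Finset.mem_filter.1 hr).2 hself
        rw [Finset.mem_filter, A.flip_apply_of_ne hrp] at hr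
        exact Finset.mem_filter.2 hr
      · rw [A.flip_apply_of_ne (by rintro rfl; omega)]
        exact hAB r hr
    · exact ⟨A, hA, p, hpm, hT, N.mem_face_iff.2 ⟨hwA, hw⟩⟩

/-- If `u` and `v` lie in the regions of patterns `A ∈ T` and `B ∉ T` with the same first `m`
layers, then the segment from `u` to `v` meets a face across which one leaves `T` by a flip in a
later layer: the segment is connected, and the regions of the patterns with these first `m` layers
are finitely many closed sets that cover it. -/
theorem exists_crossing {l m : ℕ} (hm : m ≤ l) {A B : Pattern n l} {u v : Fin (n 0) → ℝ}
    (hu : u ∈ N.region A) (hv : v ∈ N.region B) (hAB : A.truncate hm = B.truncate hm)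
    {T : Set (Pattern n l)} (hA : A ∈ T) (hB : B ∉ T) :
    ∃ A ∈ T, ∃ p : Neuron n l, m ≤ (p.1 : ℕ) ∧ A.flip p ∉ T ∧
      ∃ w ∈ segment ℝ u v, w ∈ N.face A p := by
  have key : ∀ S : Set (Pattern n l), IsClosed (⋃ D ∈ S, N.region D) := fun S =>
    S.toFinite.isClosed_biUnion fun D _ => N.isClosed_region D
  let F : Set (Pattern n l) := {D | D.truncate hm = A.truncate hm}
  have hseg : segment ℝ u v ⊆ N.region (A.truncate hm) :=
    (N.convex_region _).segment_subset (N.mem_region_truncate hm hu)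
      (hAB ▸ N.mem_region_truncate hm hv)
  have hcon := isPreconnected_closed_iff.1 (convex_segment (𝕜 := ℝ) u v).isPreconnected
    (⋃ D ∈ T ∩ F, N.region D) (⋃ D ∈ Tᶜ ∩ F, N.region D) (key _) (key _)
    (fun w hw => ?_) ⟨u, left_mem_segment ℝ u v, ?_⟩ ⟨v, right_mem_segment ℝ u v, ?_⟩
  · obtain ⟨w, hw, hwT, hwT'⟩ := hcon
    simp only [Set.mem_iUnion, exists_prop] at hwT hwT'
    obtain ⟨D, ⟨hDT, hDF⟩, hwD⟩ := hwT
    obtain ⟨E, ⟨hET, hEF⟩, hwE⟩ := hwT'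
    obtain ⟨D', hD', p, hp, hflip, hface⟩ :=
      N.exists_flip_notMem hET hwE m D hDT hwD fun r hr =>
        congrFun (congrFun (hDF.trans hEF.symm) ⟨r.1, hr⟩) r.2
    exact ⟨D', hD', p, hp, hflip, w, hw, hface⟩
  · have hD := N.mem_region_extendAt (hseg hw) l
    have hF : N.extendAt (A.truncate hm) w l ∈ F := N.truncate_extendAt hm _ w
    by_cases hT : N.extendAt (A.truncate hm) w l ∈ T
    · exact Or.inl (Set.mem_biUnion (⟨hT, hF⟩ : _ ∈ T ∩ F) hD)
    · exact Or.inr (Set.mem_biUnion (⟨hT, hF⟩ : _ ∈ Tᶜ ∩ F) hD)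
  · exact Set.mem_biUnion (⟨hA, rfl⟩ : A ∈ T ∩ F) hu
  · exact Set.mem_biUnion (⟨hB, hAB.symm⟩ : B ∈ Tᶜ ∩ F) hv

end ReLUNet

theorem IsConvexDistance.le_max {k : ℕ} {q : (Fin k → ℝ) → (Fin k → ℝ) → ℝ}
    (hq : IsConvexDistance q) (x : Fin k → ℝ) {u v w : Fin k → ℝ} (hw : w ∈ segment ℝ u v) :
    q x w ≤ max (q x u) (q x v) :=
  (hq.convex x).le_on_segment (Set.mem_univ u) (Set.mem_univ v) hw

namespace ReLUNet

variable {L : ℕ} {n : ℕ → ℕ} {C : ℕ} (N : ReLUNet L n C)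
  (q : (Fin (n 0) → ℝ) → (Fin (n 0) → ℝ) → ℝ) (x : Fin (n 0) → ℝ) (y : Fin C)

theorem regionDist_le_decisionBound (A : Pattern n L) :
    N.regionDist q x A ≤ N.decisionBound q x A y :=
  le_iInf₂ fun _ _ => le_iInf₂ fun v hv => iInf₂_le v fun c hc => hv c (Or.inl hc)

/-! ### Runs of LayerCert-Basic -/

theorem mem_newSiblings {seen : Set ((l : ℕ) × Pattern n l)} {l : ℕ} {A : Pattern n l}
    {p : Neuron n l} :
    p ∈ N.newSiblings seen A ↔ IsNewSibling seen A p ∧ (N.face A p).Nonempty := by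
  simp [newSiblings]

theorem mem_layerPushes {seen : Set ((l : ℕ) × Pattern n l)} {l : ℕ} {A : Pattern n l}
    {m : Neuron n l → Fin (n 0) → ℝ} {e : LayerEntry n} :
    e ∈ N.layerPushes q x seen A m ↔
      ∃ p ∈ N.newSiblings seen A, ⟨((q x (m p) : ℝ) : EReal), l, A.flip p, m p⟩ = e := by
  simp [layerPushes]

/-- What holds at a state `st` of LayerCert-Basic, when `E` is the set of the queue entries that
have been processed so far. -/
structure IsLayerHistory (U : EReal) (st : LayerState n C) (E : Set (LayerEntry n)) : Prop where
  start : (⟨0, 1, N.actPattern x 1, x⟩ : LayerEntry n) ∈ st.queue ∨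
    (⟨0, 1, N.actPattern x 1, x⟩ : LayerEntry n) ∈ E
  level_le : ∀ e, e ∈ st.queue ∨ e ∈ E → e.level ≤ L
  point_mem : ∀ e, e ∈ st.queue ∨ e ∈ E → e.point ∈ N.region e.pattern
  prio_eq : ∀ e, e ∈ st.queue ∨ e ∈ E → e.prio = ((q x e.point : ℝ) : EReal)
  next : ∀ e ∈ E, e.level ≠ L →
    (⟨e.prio, e.level + 1, N.nextLayer e.pattern e.point, e.point⟩ : LayerEntry n) ∈ st.queue ∨
      (⟨e.prio, e.level + 1, N.nextLayer e.pattern e.point, e.point⟩ : LayerEntry n) ∈ E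
  sibling : ∀ e ∈ E, ∀ p : Neuron n e.level, (p.1 : ℕ) + 1 = e.level →
    (N.face e.pattern p).Nonempty →
    (⟨e.level, e.pattern.flip p⟩ : (l : ℕ) × Pattern n l) ∈ st.seen
  /-- The entry through which a pattern was first seen has the right priority, except for the
  points that an earlier entry of the same pattern accounts for. -/
  seen : ∀ (l : ℕ) (A : Pattern n l), (⟨l, A⟩ : (l : ℕ) × Pattern n l) ∈ st.seen →
    ∃ d v, ((⟨d, l, A, v⟩ : LayerEntry n) ∈ st.queue ∨ (⟨d, l, A, v⟩ : LayerEntry n) ∈ E) ∧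
      ∀ w ∈ N.region A, d ≤ ((q x w : ℝ) : EReal) ∨
        ∃ d' v', (⟨d', l, A, v'⟩ : LayerEntry n) ∈ E ∧ d' ≤ ((q x w : ℝ) : EReal)
  bound_le : st.bound ≤ U
  bound_le_decisionBound : ∀ d A v, (⟨d, L, A, v⟩ : LayerEntry n) ∈ E →
    st.bound ≤ N.decisionBound q x A y
  bound_eq : st.bound = U ∨
    ∃ d A v, (⟨d, L, A, v⟩ : LayerEntry n) ∈ E ∧ st.bound = N.decisionBound q x A y
  prio_lt : ∀ e ∈ E, e.prio < U
  /-- Every full pattern that is closer to `x` than a processed entry was processed before this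
  entry, hence did not lower the bound below the priority of the entry. -/
  prio_lt_decisionBound : ∀ e ∈ E, ∀ A : Pattern n L, N.regionDist q x A < e.prio →
    e.prio < N.decisionBound q x A y
  solved : ∀ P ∈ st.solved,
    (∃ d A v, (⟨d, L, A, v⟩ : LayerEntry n) ∈ E ∧ P ∈ N.boundaryPrograms q x A y) ∨
    ∃ e ∈ E, ∃ p : Neuron n e.level, (p.1 : ℕ) + 1 = e.level ∧
      P = N.faceProgram q x e.pattern p

variable {N q x y}

theorem isLayerHistory_init (hL : 1 ≤ L) (hq : IsConvexDistance q) (U : EReal) :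
    N.IsLayerHistory q x y U (N.layerInit x U) ∅ where
  start := by simp [layerInit]
  level_le := by simpa [layerInit] using hL
  point_mem := by simpa [layerInit] using N.mem_region_actPattern x 1
  prio_eq := by simp [layerInit, (hq.eq_zero_iff x x).2 rfl]
  next := by simp
  sibling := by simp
  seen := by simp [layerInit]
  bound_le := le_rfl
  bound_le_decisionBound := by simp
  bound_eq := Or.inl rfl
  prio_lt := by simp
  prio_lt_decisionBound := by simp
  solved := by simp [layerInit]

/-- Best-first completeness of LayerCert-Basic: once all entries left in the queue have priority
above `r`, every pattern whose region contains a point at distance at most `r` from `x` has been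
processed with priority at most `r`. -/
theorem IsLayerHistory.exists_processed (hq : IsConvexDistance q) {U : EReal} {st : LayerState n C}
    {E : Set (LayerEntry n)} (h : N.IsLayerHistory q x y U st E) {r : ℝ}
    (hr : ∀ e ∈ st.queue, (r : EReal) < e.prio) {v : Fin (n 0) → ℝ} (hv : q x v ≤ r) (l : ℕ)
    (hl : l + 1 ≤ L) (A : Pattern n (l + 1)) (hA : v ∈ N.region A) :
    ∃ d v', (⟨d, l + 1, A, v'⟩ : LayerEntry n) ∈ E ∧ d ≤ (r : EReal) := by
  have hE : ∀ e : LayerEntry n, e ∈ st.queue ∨ e ∈ E → e.prio ≤ (r : EReal) → e ∈ E :=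
    fun e he hle => he.resolve_left fun hmem => (hr e hmem).not_ge hle
  induction l with
  | zero =>
    -- The induction starts below the first layer, where the whole space is one region.
    have hr0 : (0 : EReal) ≤ (r : EReal) := by exact_mod_cast (hq.nonneg x v).trans hv
    have hx : (⟨0, 1, N.actPattern x 1, x⟩ : LayerEntry n) ∈ E := hE _ h.start hr0
    by_contra hcon
    obtain ⟨B, ⟨d, v', hB, hd⟩, p, hp, hflip, w, hw, hface⟩ := N.exists_crossing (Nat.zero_le 1)
      (N.mem_region_actPattern x 1) hA (by funext i; exact i.elim0)
      (T := {A | ∃ d v', (⟨d, 1, A, v'⟩ : LayerEntry n) ∈ E ∧ d ≤ (r : EReal)})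
      ⟨0, x, hx, hr0⟩ hcon
    have hqw : q x w ≤ r := (hq.le_max x hw).trans
      (max_le (by rw [(hq.eq_zero_iff x x).2 rfl]; exact (hq.nonneg x v).trans hv) hv)
    have hqw' : ((q x w : ℝ) : EReal) ≤ r := by exact_mod_cast hqw
    obtain ⟨d₁, v₁, hmem, hprio⟩ := h.seen _ _ (h.sibling _ hB p
      (by have := p.1.2; simp only at this ⊢; omega) ⟨w, hface⟩)
    refine hflip ?_
    rcases hprio w (N.mem_face_iff.1 hface).2 with h1 | ⟨d₂, v₂, h2, h3⟩
    · exact ⟨d₁, v₁, hE _ hmem (h1.trans hqw'), h1.trans hqw'⟩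
    · exact ⟨d₂, v₂, h2, h3.trans hqw'⟩
  | succ l ih =>
    obtain ⟨d₀, v₀, h₀, hd₀⟩ := ih (by omega) (A.truncate (Nat.le_succ _))
      (N.mem_region_truncate _ hA)
    have hx := hE _ (h.next _ h₀ (by simp only; omega)) hd₀
    have hv₀ := h.point_mem _ (Or.inr hx)
    have hqv₀ : q x v₀ ≤ r := by
      have := h.prio_eq _ (Or.inr hx)
      simp only at this
      rw [this] at hd₀
      exact_mod_cast hd₀
    by_contra hcon
    obtain ⟨B, ⟨d, v', hB, hd⟩, p, hp, hflip, w, hw, hface⟩ := N.exists_crossing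
      (Nat.le_succ (l + 1)) hv₀ hA (N.truncate_extendAt _ (A.truncate (Nat.le_succ _)) v₀)
      (T := {A | ∃ d v', (⟨d, l + 1 + 1, A, v'⟩ : LayerEntry n) ∈ E ∧ d ≤ (r : EReal)})
      ⟨d₀, v₀, hx, hd₀⟩ hcon
    have hqw : q x w ≤ r := (hq.le_max x hw).trans (max_le hqv₀ hv)
    have hqw' : ((q x w : ℝ) : EReal) ≤ r := by exact_mod_cast hqw
    obtain ⟨d₁, v₁, hmem, hprio⟩ := h.seen _ _ (h.sibling _ hB p
      (by have := p.1.2; simp only at this ⊢; omega) ⟨w, hface⟩)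
    refine hflip ?_
    rcases hprio w (N.mem_face_iff.1 hface).2 with h1 | ⟨d₂, v₂, h2, h3⟩
    · exact ⟨d₁, v₁, hE _ hmem (h1.trans hqw'), h1.trans hqw'⟩
    · exact ⟨d₂, v₂, h2, h3.trans hqw'⟩

/-- The common part of the two kinds of steps of LayerCert-Basic. -/
theorem IsLayerHistory.step (hq : IsConvexDistance q) (hL : 1 ≤ L) {U : EReal}
    {st st' : LayerState n C} {E : Set (LayerEntry n)} (h : N.IsLayerHistory q x y U st E) {e : LayerEntry n}
    {Q : Multiset (LayerEntry n)} {m : Neuron n e.level → Fin (n 0) → ℝ}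
    (hpop : PopsMin st.queue LayerEntry.prio e Q) (hU : ¬ st.bound ≤ e.prio)
    (hm : N.IsPriorityChoice q x st.seen e.pattern m)
    (hqueue : ∀ e', e' ∈ st'.queue ↔ e' ∈ Q ∨ e' ∈ N.layerPushes q x st.seen e.pattern m ∨
      e.level ≠ L ∧ e' = ⟨e.prio, e.level + 1, N.nextLayer e.pattern e.point, e.point⟩)
    (hseen : st'.seen = N.layerSeen st.seen e.pattern)
    (hle : st'.bound ≤ st.bound)
    (hleD : ∀ d A v, (⟨d, L, A, v⟩ : LayerEntry n) = e → st'.bound ≤ N.decisionBound q x A y)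
    (heq : st'.bound = st.bound ∨
      ∃ d A v, (⟨d, L, A, v⟩ : LayerEntry n) = e ∧ st'.bound = N.decisionBound q x A y)
    (hsolved : ∀ P ∈ st'.solved, P ∈ st.solved ∨
      (∃ d A v, (⟨d, L, A, v⟩ : LayerEntry n) = e ∧ P ∈ N.boundaryPrograms q x A y) ∨
      P ∈ N.layerFacePrograms q x st.seen e.pattern) :
    N.IsLayerHistory q x y U st' (insert e E) := by
  have hold : ∀ e', e' ∈ st.queue ∨ e' ∈ E → e' ∈ st'.queue ∨ e' ∈ insert e E := by
    rintro e' (he | he)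
    · rw [hpop.1, Multiset.mem_cons] at he
      rcases he with he | he
      · exact Or.inr (Or.inl he)
      · exact Or.inl ((hqueue e').2 (Or.inl he))
    · exact Or.inr (Or.inr he)
  have heq' : e ∈ st.queue ∨ e ∈ E := by
    rw [hpop.1]
    exact Or.inl (Multiset.mem_cons_self e Q)
  have hpoint := h.point_mem e heq'
  have hprio := h.prio_eq e heq'
  have hnew : ∀ e', e' ∈ st'.queue ∨ e' ∈ insert e E → (e' ∈ st.queue ∨ e' ∈ E) ∨
      e' ∈ N.layerPushes q x st.seen e.pattern m ∨
      e.level ≠ L ∧ e' = ⟨e.prio, e.level + 1, N.nextLayer e.pattern e.point, e.point⟩ := by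
    rintro e' (he | rfl | he)
    · rcases (hqueue e').1 he with he | he
      · exact Or.inl (Or.inl (hpop.1 ▸ Multiset.mem_cons_of_mem he))
      · exact Or.inr he
    · exact Or.inl heq'
    · exact Or.inl (Or.inr he)
  have hmin : ∀ e' ∈ st.queue, e.prio ≤ e'.prio := by
    intro e' he
    rw [hpop.1, Multiset.mem_cons] at he
    rcases he with rfl | he
    · exact le_rfl
    · exact hpop.2 e' he
  have hproc : ∀ r : ℝ, (r : EReal) < e.prio → ∀ v, q x v ≤ r → ∀ l, 1 ≤ l → l ≤ L →
      ∀ A : Pattern n l, v ∈ N.region A →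
        ∃ d v', (⟨d, l, A, v'⟩ : LayerEntry n) ∈ E ∧ d ≤ (r : EReal) := by
    intro r hr v hv l hl1 hl A hA
    obtain ⟨l, rfl⟩ : ∃ k, l = k + 1 := ⟨l - 1, by omega⟩
    exact h.exists_processed hq (fun e' he => hr.trans_le (hmin e' he)) hv l hl A hA
  refine
    { start := hold _ h.start
      level_le := fun e' he => ?_
      point_mem := fun e' he => ?_
      prio_eq := fun e' he => ?_
      next := ?_
      sibling := ?_
      seen := ?_
      bound_le := hle.trans h.bound_le
      bound_le_decisionBound := ?_
      bound_eq := ?_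
      prio_lt := ?_
      prio_lt_decisionBound := ?_
      solved := ?_ }
  · rcases hnew e' he with he | he | ⟨hl, rfl⟩
    · exact h.level_le e' he
    · obtain ⟨p, -, rfl⟩ := (N.mem_layerPushes q x).1 he
      exact h.level_le e heq'
    · have := h.level_le e heq'
      simp only
      omega
  · rcases hnew e' he with he | he | ⟨hl, rfl⟩
    · exact h.point_mem e' he
    · obtain ⟨p, hp, rfl⟩ := (N.mem_layerPushes q x).1 he
      exact (N.mem_face_iff.1 (hm p hp).1).2
    · exact N.mem_region_extendAt hpoint _
  · rcases hnew e' he with he | he | ⟨hl, rfl⟩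
    · exact h.prio_eq e' he
    · obtain ⟨p, -, rfl⟩ := (N.mem_layerPushes q x).1 he
      rfl
    · exact hprio
  · rintro e' (rfl | he) hl
    · exact Or.inl ((hqueue _).2 (Or.inr (Or.inr ⟨hl, rfl⟩)))
    · exact hold _ (h.next e' he hl)
  · rw [hseen]
    rintro e' (rfl | he) p hp hface
    · by_cases hs : (⟨e'.level, e'.pattern.flip p⟩ : (l : ℕ) × Pattern n l) ∈ st.seen
      · exact Or.inl hs
      · exact Or.inr ⟨p, N.mem_newSiblings.2 ⟨⟨hp, hs⟩, hface⟩, rfl⟩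
    · exact Or.inl (h.sibling e' he p hp hface)
  · rw [hseen]
    rintro l A (hA | ⟨p, hp, hA⟩)
    · obtain ⟨d, v, hmem, hd⟩ := h.seen l A hA
      refine ⟨d, v, hold _ hmem, fun w hw => (hd w hw).imp_right ?_⟩
      rintro ⟨d', v', h1, h2⟩
      exact ⟨d', v', Or.inr h1, h2⟩
    · cases hA
      refine ⟨_, m p, Or.inl ((hqueue _).2 (Or.inr (Or.inl
        ((N.mem_layerPushes q x).2 ⟨p, hp, rfl⟩)))), fun w hw => ?_⟩
      -- The new priority is at most the larger of `q x w` and the priority of `e`. If the latter is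
      -- larger than `q x w`, then the new sibling was processed before as a next layer.
      rcases le_or_gt e.prio ((q x w : ℝ) : EReal) with hle' | hlt
      · left
        obtain ⟨c, hc, hcf⟩ := N.exists_mem_segment_face (N.mem_newSiblings.1 hp).1.1 hpoint hw
        rw [hprio] at hle'
        have h1 : q x e.point ≤ q x w := by exact_mod_cast hle'
        have h2 := ((hm p hp).2 c hcf).trans ((hq.le_max x hc).trans (max_le h1 le_rfl))
        exact_mod_cast h2
      · right
        have hlev := (N.mem_newSiblings.1 hp).1.1
        obtain ⟨d', v', h1, h2⟩ := hproc _ hlt w le_rfl e.level (by omega)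
          (h.level_le e heq') _ hw
        exact ⟨d', v', Or.inr h1, h2⟩
  · rintro d A v (he | he)
    · exact hleD d A v he
    · exact hle.trans (h.bound_le_decisionBound d A v he)
  · rcases heq with heq | ⟨d, A, v, he, hb⟩
    · rw [heq]
      rcases h.bound_eq with hb | ⟨d, A, v, he, hb⟩
      · exact Or.inl hb
      · exact Or.inr ⟨d, A, v, Or.inr he, hb⟩
    · exact Or.inr ⟨d, A, v, Or.inl he, hb⟩
  · rintro e' (rfl | he)
    · exact (not_le.1 hU).trans_le h.bound_le
    · exact h.prio_lt e' he
  · rintro e' (rfl | he) A hA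
    · obtain ⟨v, hv, hlt⟩ : ∃ v ∈ N.region A, ((q x v : ℝ) : EReal) < e'.prio := by
        simpa only [regionDist, iInf_lt_iff, exists_prop] using hA
      obtain ⟨d, v', h1, -⟩ := hproc _ hlt v le_rfl L hL le_rfl A hv
      exact (not_le.1 hU).trans_le (h.bound_le_decisionBound d A v' h1)
    · exact h.prio_lt_decisionBound e' he A hA
  · intro P hP
    rcases hsolved P hP with hP | ⟨d, A, v, he, hP⟩ | ⟨p, hp, rfl⟩
    · rcases h.solved P hP with ⟨d, A, v, he, hP⟩ | ⟨e', he, hP⟩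
      · exact Or.inl ⟨d, A, v, Or.inr he, hP⟩
      · exact Or.inr ⟨e', Or.inr he, hP⟩
    · exact Or.inl ⟨d, A, v, Or.inl he, hP⟩
    · exact Or.inr ⟨e, Or.inl rfl, p, hp.1, rfl⟩

theorem IsLayerHistory.exists_of_step (hq : IsConvexDistance q) (hL : 1 ≤ L) {U : EReal}
    {st st' : LayerState n C} {E : Set (LayerEntry n)} (h : N.IsLayerHistory q x y U st E)
    (hst : N.LayerStep q x y st st') : ∃ E', N.IsLayerHistory q x y U st' E' := by
  cases hst with
  | last d A v Q m hpop hU hm =>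
    refine ⟨_, h.step hq hL hpop hU hm (fun e' => ?_) rfl (min_le_right _ _) ?_ ?_ ?_⟩
    · simp
    · rintro d' A' v' he
      cases he
      exact min_le_left _ _
    · rcases min_choice (N.decisionBound q x A y) st.bound with hb | hb
      · exact Or.inr ⟨d, A, v, rfl, hb⟩
      · exact Or.inl hb
    · rintro P ((hP | hP) | hP)
      · exact Or.inl hP
      · exact Or.inr (Or.inl ⟨d, A, v, rfl, hP⟩)
      · exact Or.inr (Or.inr hP)
  | inner d l A v Q m hpop hU hl hm =>
    refine ⟨_, h.step hq hL hpop hU hm (fun e' => ?_) rfl le_rfl ?_ (Or.inl rfl) ?_⟩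
    · simp only [Multiset.mem_cons, Multiset.mem_add, ne_eq, hl, not_false_eq_true, true_and]
      tauto
    · rintro d' A' v' he
      exact absurd (congrArg LayerEntry.level he).symm hl
    · rintro P (hP | hP)
      · exact Or.inl hP
      · exact Or.inr (Or.inr hP)

theorem exists_isLayerHistory (hq : IsConvexDistance q) (hL : 1 ≤ L) {U : EReal}
    {st : LayerState n C}
    (hst : Relation.ReflTransGen (N.LayerStep q x y) (N.layerInit x U) st) :
    ∃ E, N.IsLayerHistory q x y U st E := by
  induction hst with
  | refl => exact ⟨∅, isLayerHistory_init hL hq U⟩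
  | tail _ hstep ih =>
    obtain ⟨E, hE⟩ := ih
    exact hE.exists_of_step hq hL hstep

/-- The value that LayerCert-Basic returns is at most the distance from `x` to the decision boundary
in any full region. -/
theorem IsLayerHistory.bound_le_of_halts (hq : IsConvexDistance q) (hL : 1 ≤ L) {U : EReal}
    {st : LayerState n C} {E : Set (LayerEntry n)} (h : N.IsLayerHistory q x y U st E)
    (hhalt : st.Halts) (A : Pattern n L) : st.bound ≤ N.decisionBound q x A y := by
  by_cases hA : ∃ d v, (⟨d, L, A, v⟩ : LayerEntry n) ∈ E
  · obtain ⟨d, v, hA⟩ := hA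
    exact h.bound_le_decisionBound d A v hA
  refine le_trans (le_iInf₂ fun v hv => ?_) (N.regionDist_le_decisionBound q x y A)
  by_contra! hlt
  have hqueue : ∀ e ∈ st.queue, ((q x v : ℝ) : EReal) < e.prio := by
    intro e he
    rcases hhalt with h0 | ⟨e₀, Q, hpop, hle⟩
    · rw [h0] at he
      exact absurd he (Multiset.notMem_zero e)
    · refine hlt.trans_le (hle.trans ?_)
      rw [hpop.1, Multiset.mem_cons] at he
      rcases he with rfl | he
      · exact le_rfl
      · exact hpop.2 e he
  obtain ⟨k, rfl⟩ : ∃ k, L = k + 1 := ⟨L - 1, by omega⟩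
  obtain ⟨d, v', he, -⟩ := h.exists_processed hq hqueue le_rfl k le_rfl A hv
  exact hA ⟨d, v', he⟩

/-- If the returned value is not the distance from `x` to a full region, then it exceeds the
priorities of all processed entries. -/
theorem IsLayerHistory.prio_lt_bound {U : EReal}
    {st : LayerState n C} {E : Set (LayerEntry n)} (h : N.IsLayerHistory q x y U st E)
    (hε : ∀ A : Pattern n L, (N.region A).Nonempty → st.bound ≠ N.regionDist q x A)
    {e : LayerEntry n} (he : e ∈ E) : e.prio < st.bound := by
  rcases h.bound_eq with hb | ⟨d, A, v, hA, hb⟩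
  · rw [hb]
    exact h.prio_lt e he
  · by_contra! hle
    have hne := hε A ⟨v, h.point_mem _ (Or.inr hA)⟩
    have hlt : N.regionDist q x A < st.bound :=
      lt_of_le_of_ne (hb ▸ N.regionDist_le_decisionBound q x y A) hne.symm
    have := h.prio_lt_decisionBound e he A (hlt.trans_le hle)
    rw [← hb] at this
    exact this.not_ge hle

/-! ### Runs of GeoCert -/

variable (N q x y)

theorem mem_geoPushes {seen : Set (Pattern n L)} {A : Pattern n L} {e : EReal × Pattern n L} :
    e ∈ N.geoPushes q x seen A ↔ ∃ p, A.flip p ∉ seen ∧ (N.face A p).Nonempty ∧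
      ((N.faceProgram q x A p).value, A.flip p) = e := by
  simp [geoPushes, and_assoc]

/-- What holds at a state `st` of GeoCert. The seen patterns are those that have been processed. -/
structure IsGeoHistory (U : EReal) (st : GeoState L n C) : Prop where
  start : N.actPattern x L ∈ st.seen ∨ (0, N.actPattern x L) ∈ st.queue
  neighbour : ∀ A ∈ st.seen, ∀ p, (N.face A p).Nonempty → A.flip p ∈ st.seen ∨
    ((N.faceProgram q x A p).value, A.flip p) ∈ st.queue
  le_bound : ∀ ε ≤ U, (∀ A ∈ st.seen, ε ≤ N.decisionBound q x A y) → ε ≤ st.bound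
  boundary_solved : ∀ A ∈ st.seen, N.boundaryPrograms q x A y ⊆ st.solved
  /-- A face program is skipped only if the neighbour was processed before, and then it was solved
  from the other side. -/
  face_solved : ∀ A ∈ st.seen, ∀ p, N.faceProgram q x A p ∈ st.solved ∨
    N.faceProgram q x (A.flip p) p ∈ st.solved ∧ A.flip p ∈ st.seen

variable {N q x y}

theorem isGeoHistory_init (U : EReal) : N.IsGeoHistory q x y U (N.geoInit x U) where
  start := by simp [geoInit]
  neighbour := by simp [geoInit]
  le_bound := fun _ h _ => h
  boundary_solved := by simp [geoInit]
  face_solved := by simp [geoInit]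

theorem IsGeoHistory.step {U : EReal} {st st' : GeoState L n C} (h : N.IsGeoHistory q x y U st)
    (hst : N.GeoStep q x y st st') : N.IsGeoHistory q x y U st' := by
  cases hst with
  | skip d A Q hpop hA =>
    have hQ : ∀ e ∈ st.queue, e.2 ∈ st.seen ∨ e ∈ Q := by
      intro e he
      rw [hpop.1, Multiset.mem_cons] at he
      rcases he with rfl | he
      · exact Or.inl hA
      · exact Or.inr he
    exact
      { h with
        start := h.start.elim Or.inl (hQ _)
        neighbour := fun B hB p hp => (h.neighbour B hB p hp).elim Or.inl (hQ _) }
  | process d A Q hpop hA hU =>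
    have hQ : ∀ e ∈ st.queue, e.2 ∈ insert A st.seen ∨ e ∈ Q + N.geoPushes q x (insert A st.seen) A
        := by
      intro e he
      rw [hpop.1, Multiset.mem_cons] at he
      rcases he with rfl | he
      · exact Or.inl (Or.inl rfl)
      · exact Or.inr (Multiset.mem_add.2 (Or.inl he))
    refine
      { start := h.start.elim (fun hs => Or.inl (Or.inr hs)) (hQ _)
        neighbour := ?_
        le_bound := ?_
        boundary_solved := ?_
        face_solved := ?_ }
    · rintro B (rfl | hB) p hp
      · by_cases hs : B.flip p ∈ insert B st.seen
        · exact Or.inl hs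
        · refine Or.inr (Multiset.mem_add.2 (Or.inr ?_))
          exact (N.mem_geoPushes q x).2 ⟨p, hs, hp, rfl⟩
      · exact (h.neighbour B hB p hp).elim (fun hs => Or.inl (Or.inr hs)) (hQ _)
    · intro ε hε hall
      exact le_min (hall A (Or.inl rfl)) (h.le_bound ε hε fun B hB => hall B (Or.inr hB))
    · rintro B (rfl | hB) P hP
      · exact Or.inl (Or.inr hP)
      · exact Or.inl (Or.inl (h.boundary_solved B hB hP))
    · rintro B (rfl | hB) p
      · by_cases hs : B.flip p ∈ st.seen
        · rcases h.face_solved _ hs p with h1 | ⟨-, h2⟩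
          · exact Or.inr ⟨Or.inl (Or.inl h1), Or.inr hs⟩
          · rw [B.flip_flip] at h2
            exact absurd h2 hA
        · refine Or.inl (Or.inr ⟨p, ?_, rfl⟩)
          rintro (h1 | h1)
          · exact B.flip_ne p h1
          · exact hs h1
      · exact (h.face_solved B hB p).imp (fun h1 => Or.inl (Or.inl h1))
          fun h1 => ⟨Or.inl (Or.inl h1.1), Or.inr h1.2⟩

theorem isGeoHistory_of_reflTransGen {U : EReal} {st : GeoState L n C}
    (hst : Relation.ReflTransGen (N.GeoStep q x y) (N.geoInit x U) st) :
    N.IsGeoHistory q x y U st := by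
  induction hst with
  | refl => exact isGeoHistory_init U
  | tail _ hstep ih => exact ih.step hstep

/-- When GeoCert stops, it has processed all full patterns whose regions contain a point closer to
`x` than the returned value. -/
theorem IsGeoHistory.mem_seen_of_halts (hq : IsConvexDistance q) {U : EReal} {st : GeoState L n C}
    (h : N.IsGeoHistory q x y U st) (hhalt : st.Halts) {v : Fin (n 0) → ℝ}
    (hv : ((q x v : ℝ) : EReal) < st.bound) {A : Pattern n L} (hA : v ∈ N.region A) :
    A ∈ st.seen := by
  have hqueue : ∀ e ∈ st.queue, st.bound ≤ e.1 := by
    intro e he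
    rcases hhalt with h0 | ⟨d, B, Q, hpop, -, hle⟩
    · rw [h0] at he
      exact absurd he (Multiset.notMem_zero e)
    · rw [hpop.1, Multiset.mem_cons] at he
      rcases he with rfl | he
      · exact hle
      · exact hle.trans (hpop.2 e he)
  have hx : N.actPattern x L ∈ st.seen := by
    refine h.start.resolve_right fun hmem => ?_
    have h0 : (0 : EReal) ≤ ((q x v : ℝ) : EReal) := by exact_mod_cast hq.nonneg x v
    exact ((hqueue _ hmem).trans h0).not_gt hv
  by_contra hcon
  obtain ⟨B, hB, p, -, hflip, w, hw, hface⟩ := N.exists_crossing (Nat.zero_le L)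
    (N.mem_region_actPattern x L) hA (by funext i; exact i.elim0) hx hcon
  refine hflip ((h.neighbour B hB p ⟨w, hface⟩).resolve_right fun hmem => ?_)
  have hqw : q x w ≤ q x v := (hq.le_max x hw).trans
    (max_le (by rw [(hq.eq_zero_iff x x).2 rfl]; exact hq.nonneg x v) le_rfl)
  have h1 : (N.faceProgram q x B p).value ≤ ((q x w : ℝ) : EReal) := iInf₂_le w hface
  have h2 : ((q x w : ℝ) : EReal) ≤ ((q x v : ℝ) : EReal) := by exact_mod_cast hqw
  exact ((hqueue _ hmem).trans (h1.trans h2)).not_gt hv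

end ReLUNet

/-! ### Programs and their constraints -/

namespace ReLUNet

variable {L : ℕ} {n : ℕ → ℕ} {C : ℕ} (N : ReLUNet L n C)
  (q : (Fin (n 0) → ℝ) → (Fin (n 0) → ℝ) → ℝ) (x : Fin (n 0) → ℝ)

/-- The constraint comes from a neuron of one of the first `l` hidden layers. -/
def IsBelow (l : ℕ) (c : LinConstraint n C) : Prop :=
  match c.label with
  | .neuron i _ _ => i < l
  | .boundary _ _ => False

theorem signConstraint_congr {l l' : ℕ} {A : Pattern n l} {B : Pattern n l'} {p : Neuron n l}
    {r : Neuron n l'} {s : ℤˣ}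
    (hlabel : (N.signConstraint A p s).label = (N.signConstraint B r s).label)
    (h : ∀ v, N.affPreact A v p.1 = N.affPreact B v p.1) :
    N.signConstraint A p s = N.signConstraint B r s := by
  obtain ⟨⟨i, hi⟩, j⟩ := p
  obtain ⟨⟨i', hi'⟩, j'⟩ := r
  simp only [signConstraint, ConstraintLabel.neuron.injEq] at hlabel
  obtain ⟨rfl, hj, -⟩ := hlabel
  obtain rfl := eq_of_heq hj
  simp only at h
  simp only [signConstraint, h]

theorem signConstraint_truncate {m l : ℕ} (h : m ≤ l) (A : Pattern n l) (p : Neuron n m)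
    (s : ℤˣ) : N.signConstraint (A.truncate h) p s = N.signConstraint A (liftNeuron h p) s :=
  N.signConstraint_congr rfl fun v => N.affPreact_truncate h A v p.1.2.le

theorem signConstraint_flip {l : ℕ} (A : Pattern n l) {p : Neuron n l} (hp : (p.1 : ℕ) + 1 = l)
    (r : Neuron n l) (s : ℤˣ) : N.signConstraint (A.flip p) r s = N.signConstraint A r s :=
  N.signConstraint_congr rfl fun v => N.affPreact_flip A hp v r.1.2

/-- Two neighbouring siblings have the same face program, since the affine functions in it do not
depend on the signs of the last layer. -/
theorem faceConstraints_flip {l : ℕ} (A : Pattern n l) {p : Neuron n l}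
    (hp : (p.1 : ℕ) + 1 = l) : N.faceConstraints (A.flip p) p = N.faceConstraints A p := by
  have key : ∀ A : Pattern n l, N.faceConstraints (A.flip p) p ⊆ N.faceConstraints A p := by
    rintro A c (⟨r, rfl⟩ | hc)
    · simp only [N.signConstraint_flip A hp]
      by_cases hr : r = p
      · subst hr
        rcases Int.units_eq_one_or (A.flip r r.1 r.2) with h | h <;> rw [h]
        · exact Or.inr (Or.inl rfl)
        · exact Or.inr (Or.inr rfl)
      · rw [A.flip_apply_of_ne hr]
        exact Or.inl ⟨r, rfl⟩
    · simp only [N.signConstraint_flip A hp] at hc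
      exact Or.inr hc
  refine (key A).antisymm ?_
  have := key (A.flip p)
  rwa [A.flip_flip] at this

/-- The face constraints of the first `m` layers of `A` are the face constraints of `A` that come
from these layers. -/
theorem faceConstraints_truncate {m l : ℕ} (h : m ≤ l) (A : Pattern n l) (p : Neuron n m) :
    N.faceConstraints (A.truncate h) p =
      {c ∈ N.faceConstraints A (liftNeuron h p) | IsBelow m c} := by
  ext c
  constructor
  · rintro (⟨r, rfl⟩ | rfl | rfl)
    · simp only [N.signConstraint_truncate h]
      exact ⟨Or.inl ⟨liftNeuron h r, rfl⟩, r.1.2⟩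
    · rw [N.signConstraint_truncate h]
      exact ⟨Or.inr (Or.inl rfl), p.1.2⟩
    · rw [N.signConstraint_truncate h]
      exact ⟨Or.inr (Or.inr rfl), p.1.2⟩
  · rintro ⟨⟨r, rfl⟩ | rfl | rfl, hc⟩
    · exact Or.inl ⟨⟨⟨r.1, hc⟩, r.2⟩, N.signConstraint_truncate h A _ _⟩
    · exact Or.inr (Or.inl (N.signConstraint_truncate h A p _).symm)
    · exact Or.inr (Or.inr (N.signConstraint_truncate h A p _).symm)

/-- The neuron of a face is the only one both of whose signs label a constraint. -/
theorem eq_of_faceConstraints_eq {l : ℕ} {A B : Pattern n l} {p r : Neuron n l}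
    (h : N.faceConstraints A p = N.faceConstraints B r) : p = r := by
  by_contra hne
  have key : ∀ s, N.signConstraint A p s ∈ N.faceConstraints A p → s = B p.1 p.2 := by
    intro s hs
    have inj : ∀ (t : Neuron n l) (s' : ℤˣ),
        N.signConstraint B t s' = N.signConstraint A p s → t = p ∧ s' = s := by
      rintro ⟨⟨i, hi⟩, j⟩ s' ht
      obtain ⟨⟨i', hi'⟩, j'⟩ := p
      have ht := congrArg LinConstraint.label ht
      simp only [signConstraint, ConstraintLabel.neuron.injEq] at ht
      obtain ⟨rfl, hj, hs'⟩ := ht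
      obtain rfl := eq_of_heq hj
      exact ⟨rfl, hs'⟩
    rw [h] at hs
    rcases hs with ⟨t, ht⟩ | ht | ht
    · obtain ⟨rfl, hs⟩ := inj _ _ ht
      exact hs.symm
    · exact absurd (inj _ _ ht.symm).1.symm hne
    · exact absurd (inj _ _ ht.symm).1.symm hne
  have h1 := key 1 (Or.inr (Or.inl rfl))
  have h2 := key (-1) (Or.inr (Or.inr rfl))
  rw [← h1] at h2
  revert h2
  decide

theorem boundaryProgram_ne_faceProgram (A B : Pattern n L) (y j : Fin C) (p : Neuron n L) :
    N.boundaryProgram q x A y j ≠ N.faceProgram q x B p := by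
  intro h
  have hmem : N.boundaryConstraint A y j 1 ∈ N.faceConstraints B p := by
    rw [← show N.boundaryConstraints A y j = N.faceConstraints B p from
      congrArg ConvexProgram.constraints h]
    exact Or.inr (Or.inl rfl)
  rcases hmem with ⟨t, ht⟩ | ht | ht <;> cases congrArg LinConstraint.label ht

/-- The relation between a program of LayerCert-Basic and its counterpart `P'` of GeoCert: either
the two are the same boundary program, or `P'` is the face program of a full pattern at a neuron of
layer `l`, and `P` keeps the constraints of the first `l` layers. -/
def IsCounterpart (y : Fin C) (P P' : ConvexProgram n C) : Prop :=
  (P = P' ∧ ∃ (A : Pattern n L) (j : Fin C), P' = N.boundaryProgram q x A y j) ∨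
    ∃ (A : Pattern n L) (p : Neuron n L), P' = N.faceProgram q x A p ∧
      P = ⟨q x, {c ∈ P'.constraints | IsBelow ((p.1 : ℕ) + 1) c}⟩

variable {N q x}

theorem IsCounterpart.objective_eq {y : Fin C} {P P' : ConvexProgram n C}
    (h : N.IsCounterpart q x y P P') : P'.objective = P.objective := by
  rcases h with ⟨rfl, -⟩ | ⟨A, p, rfl, rfl⟩ <;> rfl

theorem IsCounterpart.constraints_subset {y : Fin C} {P P' : ConvexProgram n C}
    (h : N.IsCounterpart q x y P P') : P.constraints ⊆ P'.constraints := by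
  rcases h with ⟨rfl, -⟩ | ⟨A, p, rfl, rfl⟩
  · exact subset_rfl
  · exact Set.sep_subset _ _

theorem IsCounterpart.left_unique {y : Fin C} {P₁ P₂ P' : ConvexProgram n C}
    (h₁ : N.IsCounterpart q x y P₁ P') (h₂ : N.IsCounterpart q x y P₂ P') : P₁ = P₂ := by
  rcases h₁ with ⟨h₁, A, j, hA⟩ | ⟨A, p, hA, h₁⟩ <;>
    rcases h₂ with ⟨h₂, B, k, hB⟩ | ⟨B, r, hB, h₂⟩
  · rw [h₁, h₂]
  · exact absurd (hA.symm.trans hB) (N.boundaryProgram_ne_faceProgram q x A B y j r)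
  · exact absurd (hB.symm.trans hA) (N.boundaryProgram_ne_faceProgram q x B A y k p)
  · obtain rfl : p = r :=
      N.eq_of_faceConstraints_eq (congrArg ConvexProgram.constraints (hA.symm.trans hB))
    rw [h₁, h₂]

theorem isCounterpart_faceProgram (y : Fin C) {l : ℕ} (hl : l ≤ L) (A : Pattern n L)
    {p : Neuron n l} (hp : (p.1 : ℕ) + 1 = l) :
    N.IsCounterpart q x y (N.faceProgram q x (A.truncate hl) p)
      (N.faceProgram q x A (liftNeuron hl p)) := by
  refine Or.inr ⟨A, liftNeuron hl p, rfl, ?_⟩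
  simp only [faceProgram, N.faceConstraints_truncate hl, ConvexProgram.mk.injEq, true_and]
  simp only [liftNeuron, hp]

end ReLUNet

theorem theorem2 {L : ℕ} {n : ℕ → ℕ} {C : ℕ} (hL : 1 ≤ L) (N : ReLUNet L n C)
    (q : (Fin (n 0) → ℝ) → (Fin (n 0) → ℝ) → ℝ) (hq : IsConvexDistance q)
    (x : Fin (n 0) → ℝ) (y : Fin C) (U : EReal)
    (εLayer εGeo : EReal) (PLayer PGeo : Set (ConvexProgram n C))
    (hLayer : N.LayerCertRun q x y U εLayer PLayer)
    (hGeo : N.GeoCertRun q x y U εGeo PGeo)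
    (hε : ∀ A : Pattern n L, (N.region A).Nonempty → εLayer ≠ N.regionDist q x A) :
    ∃ φ : ConvexProgram n C → ConvexProgram n C,
      Set.MapsTo φ PLayer PGeo ∧ Set.InjOn φ PLayer ∧
        ∀ P ∈ PLayer, (φ P).objective = P.objective ∧ P.constraints ⊆ (φ P).constraints := by
  obtain ⟨st, hst, hhalt, rfl, rfl⟩ := hLayer
  obtain ⟨gt, hgt, ghalt, rfl, rfl⟩ := hGeo
  obtain ⟨E, hE⟩ := ReLUNet.exists_isLayerHistory hq hL hst
  have hG := ReLUNet.isGeoHistory_of_reflTransGen hgt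
  have hle : st.bound ≤ gt.bound :=
    hG.le_bound _ hE.bound_le fun A _ => hE.bound_le_of_halts hq hL hhalt A
  have hseen : ∀ e ∈ E, ∀ A : Pattern n L, e.point ∈ N.region A → A ∈ gt.seen := by
    intro e he A hA
    refine hG.mem_seen_of_halts hq ghalt ?_ hA
    rw [← hE.prio_eq e (Or.inr he)]
    exact (hE.prio_lt_bound hε he).trans_le hle
  have hex : ∀ P ∈ st.solved, ∃ P' ∈ gt.solved, N.IsCounterpart q x y P P' := by
    intro P hP
    rcases hE.solved P hP with ⟨d, A, v, he, hPA⟩ | ⟨e, he, p, hp, rfl⟩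
    · obtain ⟨j, -, hj⟩ := id hPA
      exact ⟨P, hG.boundary_solved A (hseen _ he A (hE.point_mem _ (Or.inr he))) hPA,
        Or.inl ⟨rfl, A, j, hj⟩⟩
    · have hl := hE.level_le e (Or.inr he)
      have htr := N.truncate_extendAt hl e.pattern e.point
      rcases hG.face_solved _ (hseen e he _ (N.mem_region_extendAt (hE.point_mem e (Or.inr he)) L))
        (liftNeuron hl p) with h | ⟨h, -⟩
      · refine ⟨_, h, ?_⟩
        have := ReLUNet.isCounterpart_faceProgram (N := N) (q := q) (x := x) y hl
          (N.extendAt e.pattern e.point L) hp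
        rwa [htr] at this
      · refine ⟨_, h, ?_⟩
        have := ReLUNet.isCounterpart_faceProgram (N := N) (q := q) (x := x) y hl
          ((N.extendAt e.pattern e.point L).flip (liftNeuron hl p)) hp
        rwa [Pattern.truncate_flip, htr, ReLUNet.faceProgram, N.faceConstraints_flip _ hp] at this
  choose! φ hφ hc using hex
  refine ⟨φ, hφ, fun P₁ h₁ P₂ h₂ h => ?_, fun P hP =>
    ⟨(hc P hP).objective_eq, (hc P hP).constraints_subset⟩⟩
  have h3 := hc P₁ h₁
  rw [h] at h3
  exact h3.left_unique (hc P₂ h₂)
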